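/- Let $\mathbb{R}_{\max}=\mathbb{R}\cup\{-\infty\}$, let $m,n\ge 1$, and let $A=(a_{ij}),B=(b_{ij})\in\mathbb{R}_{\max}^{m\times n}$ be such that neither $A$ nor $B$ has a row identically equal to $-\infty$, and no column is identically $-\infty$ in both $A$ and $B$. Write $(Ax)_i=\max_j(a_{ij}+x_j)$ and $(A^\sharp y)_j=\min_i(-a_{ij}+y_i)$ (with the convention $(-\infty)+(+\infty)=+\infty$), and let $A^\sharp B$ denote the map $x\mapsto A^\sharp(Bx)$. For an order-preserving, additively homogeneous, continuous map $f:\mathbb{R}_{\max}^n\to\mathbb{R}_{\max}^n$ let $r(f)$ be its largest eigenvalue, i.e. the largest $\mu\in\mathbb{R}_{\max}$ such that $\mu+x=f(x)$ for some $x\in\mathbb{R}_{\max}^n$ not identically $-\infty$. For $\lambda\in\mathbb{R}$ let $$h_\lambda(x)=\min\bigl(\lambda+A^\sharp Bx,\;-\lambda+B^\sharp Ax\bigr)\ \text{(componentwise)},\qquad s(\lambda)=r(h_\lambda).$$ Put $\kappa=\min(2m,n)$, $$\overline C(A,B)=\max_{i,j,k:\,a_{ij}\ne-\infty,\,b_{ik}\ne-\infty}(a_{ij}-b_{ik}),\qquad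 \underline C(A,B)=\min_{i,j,k:\,a_{ik}\ne-\infty,\,b_{ij}\ne-\infty}(a_{ik}-b_{ij}),$$ and $\Delta(A,B)=\max\bigl(\overline C(A,B),\overline C(B,A)\bigr)$. Then: 1. There exist integers $k_1,l_1,t_1,k_2,l_2,t_2$ and $\alpha_1,\alpha_2\in\mathbb{R}$ such that, for $i=1,2$, $1\le l_i\le\kappa$, $0\le t_i\le\lfloor l_i/2\rfloor$ and $k_i=l_i-2t_i$ (so $0\le k_i\le l_i$), and $$s(\lambda)=\lambda\,\frac{k_1}{l_1}+\alpha_1\ \text{ for all }\lambda\le-2\kappa^2\Delta(A,B),\qquad s(\lambda)=-\lambda\,\frac{k_2}{l_2}+\alpha_2\ \text{ for all }\lambda\ge2\kappa^2\Delta(A,B).$$ 2. If neither $A$ nor $B$ has a column identically equal to $-\infty$, then there exist real numbers $\alpha_1\le r(A^\sharp B)$ and $\alpha_2\le r(B^\sharp A)$ such that $$s(\lambda)=\lambda+\alpha_1\ \text{ for all }\lambda\le-2\kappa\Delta(A,B),\qquad s(\lambda)=-\lambda+\alpha_2\ \text{ for all }\lambda\ge2\kappa\Delta(A,B).$$ 3.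 If all entries of $A$ and $B$ are real, then $$s(\lambda)=\lambda+r(A^\sharp B)\ \text{ for all }\lambda\le\underline C(A,B),\qquad s(\lambda)=-\lambda+r(B^\sharp A)\ \text{ for all }\lambda\ge\overline C(A,B).$$ -/

import Mathlib

/-!
Max-plus conventions. The max-plus semiring `ℝ ∪ {-∞}` is the set of elements `≠ ⊤` of `EReal`;
on it max-plus multiplication is the addition of `EReal` (with `⊥` absorbing). Residuated
operators may take the value `⊤`.
-/

noncomputable section

namespace MaxPlus

/-- All entries of `A` belong to `ℝ ∪ {-∞}`. -/
def IsMaxPlus {m n : ℕ} (A : Matrix (Fin m) (Fin n) EReal) : Prop :=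
  ∀ i j, A i j ≠ ⊤

/-- `A` has no row that is identically `-∞`. -/
def NoBotRow {m n : ℕ} (A : Matrix (Fin m) (Fin n) EReal) : Prop :=
  ∀ i, ∃ j, A i j ≠ ⊥

/-- `A` has no column that is identically `-∞`. -/
def NoBotCol {m n : ℕ} (A : Matrix (Fin m) (Fin n) EReal) : Prop :=
  ∀ j, ∃ i, A i j ≠ ⊥

/-- `A` and `B` have no common column that is identically `-∞`. -/
def NoCommonBotCol {m n : ℕ} (A B : Matrix (Fin m) (Fin n) EReal) : Prop :=
  ∀ j, ∃ i, A i j ≠ ⊥ ∨ B i j ≠ ⊥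

/-- The max-plus linear map `(A x)_i = max_j (a_ij + x_j)`. -/
def act {m n : ℕ} (A : Matrix (Fin m) (Fin n) EReal) (x : Fin n → EReal) : Fin m → EReal :=
  fun i => ⨆ j, A i j + x j

/-- The residuated operator `(A♯ y)_j = min_i (-a_ij + y_i)`. With the convention
`(-∞) + (+∞) = +∞` the terms with `a_ij = -∞` are all equal to `+∞`, so they are left out. -/
def residuated {m n : ℕ} (A : Matrix (Fin m) (Fin n) EReal) (y : Fin m → EReal) : Fin n → EReal :=
  fun j => ⨅ (i : Fin m) (_ : A i j ≠ ⊥), -A i j + y i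

/-- The max-plus eigenvalues of a self-map of `(ℝ ∪ {-∞})ⁿ`: those `μ ∈ ℝ ∪ {-∞}` such that
`μ + x = f x` for some `x ∈ (ℝ ∪ {-∞})ⁿ` that is not identically `-∞`. -/
def eigenvalues {n : ℕ} (f : (Fin n → EReal) → (Fin n → EReal)) : Set EReal :=
  {μ | μ ≠ ⊤ ∧ ∃ x : Fin n → EReal,
    (∀ j, x j ≠ ⊤) ∧ (∃ j, x j ≠ ⊥) ∧ ∀ j, μ + x j = f x j}

/-- The spectral radius `r(f)`: the largest eigenvalue of `f`. -/
def specRadius {n : ℕ} (f : (Fin n → EReal) → (Fin n → EReal)) : EReal :=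
  sSup (eigenvalues f)

/-- The composition `A♯ B : x ↦ A♯ (B x)`. -/
def resComp {m n : ℕ} (A B : Matrix (Fin m) (Fin n) EReal) (x : Fin n → EReal) : Fin n → EReal :=
  residuated A (act B x)

/-- `h_lam (x) = (lam + A♯ B x) ∧ (-lam + B♯ A x)`. -/
def hFun {m n : ℕ} (A B : Matrix (Fin m) (Fin n) EReal) (lam : ℝ) (x : Fin n → EReal) :
    Fin n → EReal :=
  fun j => ((lam : EReal) + resComp A B x j) ⊓ (((-lam : ℝ) : EReal) + resComp B A x j)

/-- The spectral function `s(lam) = r(h_lam)` of the eigenproblem `A x = lam + B x`. -/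
def specFun {m n : ℕ} (A B : Matrix (Fin m) (Fin n) EReal) (lam : ℝ) : EReal :=
  specRadius (hFun A B lam)

/-- The greatest difference `a_ij - b_ik` of finite entries of `A` and `B` in the same row. -/
def Cupper {m n : ℕ} (A B : Matrix (Fin m) (Fin n) EReal) : EReal :=
  ⨆ (i : Fin m) (j : Fin n) (k : Fin n) (_ : A i j ≠ ⊥) (_ : B i k ≠ ⊥), A i j - B i k

/-- The least difference `a_ik - b_ij` of finite entries of `A` and `B` in the same row. -/
def Clower {m n : ℕ} (A B : Matrix (Fin m) (Fin n) EReal) : EReal :=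
  ⨅ (i : Fin m) (j : Fin n) (k : Fin n) (_ : A i k ≠ ⊥) (_ : B i j ≠ ⊥), A i k - B i j

/-- `Δ(A, B)`: the greatest of all `a_ij - b_ik` and `b_ij - a_ik` between finite entries. -/
def Delta {m n : ℕ} (A B : Matrix (Fin m) (Fin n) EReal) : EReal :=
  Cupper A B ⊔ Cupper B A

end MaxPlus

end

noncomputable section

namespace MaxPlus

open Filter Topology Set

/-! The map `h_λ` is the Shapley operator of a deterministic mean-payoff game: from a column, Min
picks a sign of `λ` and a row, then Max answers with a column. On real vectors such a map is
nonexpansive in the sup norm, so discounting makes it a contraction. Letting the discount factor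
tend to 1 yields a real eigenvalue that dominates every `ν` with `ν + x ≤ f x`
(`exists_greatest_eigenvalue`). Bounding `s` from below by a number, or `r(A♯B)` from below by `s(λ)
- λ`, then only takes a sub-eigenvector: `s` is 1-Lipschitz and `s(λ) ≤ λ + r(A♯B)`. Residuation
gives `s ≤ 0`.

On the finite coordinates of an eigenvector, optimal moves form a finite dynamical system. Summing
the eigenvalue equation along a cycle of length `l ≤ κ` gives `s(λ) = λ (l - 2q)/l + c`, where `q`
counts the moves with sign `-λ` and `c` is a mean of entry differences, so `|c| ≤ Δ`
(`hFun_eigenvalue_eq`). Thus `s` takes its values on finitely many lines. Distinct slopes differ by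
at least `1/κ²` and intercepts by at most `2Δ`, so no two lines cross beyond `2κ²Δ`, and continuity
keeps `s` on one of them (`exists_affine_of_finite`). Since `s ≤ 0`, that line has `2q ≤ l`.

Without `-∞` columns, `s(λ) ≤ λ + r(A♯B) ≤ λ + Δ` rules out `q ≥ 1` for `λ < -2κΔ`, and the
remaining lines are parallel. For real matrices, one term of the minimum is everywhere the smaller
one. Large positive `λ` reduces to large negative `λ` by exchanging `A` and `B`. -/

/-! ### Translations of the extended reals by real constants. -/

theorem neg_coe_add_cancel_left (c : ℝ) (x : EReal) : ((-c : ℝ) : EReal) + (c + x) = x := by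
  rw [← add_assoc, ← EReal.coe_add, neg_add_cancel, EReal.coe_zero, zero_add]

theorem coe_add_neg_cancel_left (c : ℝ) (x : EReal) : (c : EReal) + (((-c : ℝ) : EReal) + x) = x := by
  rw [← add_assoc, ← EReal.coe_add, add_neg_cancel, EReal.coe_zero, zero_add]

theorem coe_add_le_iff (c : ℝ) (x y : EReal) :
    (c : EReal) + x ≤ y ↔ x ≤ ((-c : ℝ) : EReal) + y := by
  constructor
  · intro h
    have := add_le_add_right h ((-c : ℝ) : EReal)
    rwa [neg_coe_add_cancel_left] at this
  · intro h
    have := add_le_add_right h (c : EReal)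
    rwa [coe_add_neg_cancel_left] at this

theorem le_coe_add_iff (c : ℝ) (x y : EReal) :
    x ≤ (c : EReal) + y ↔ ((-c : ℝ) : EReal) + x ≤ y := by
  rw [coe_add_le_iff, neg_neg]

/-- Addition of a real constant, as an order automorphism of `EReal`. -/
def addCoeIso (c : ℝ) : EReal ≃o EReal where
  toFun x := c + x
  invFun x := ((-c : ℝ) : EReal) + x
  left_inv x := neg_coe_add_cancel_left c x
  right_inv x := coe_add_neg_cancel_left c x
  map_rel_iff' := by
    intro x y
    change (c : EReal) + x ≤ c + y ↔ x ≤ y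
    rw [coe_add_le_iff, neg_coe_add_cancel_left]

theorem coe_add_iSup {ι : Sort*} (c : ℝ) (f : ι → EReal) :
    (c : EReal) + ⨆ i, f i = ⨆ i, ((c : EReal) + f i) :=
  (addCoeIso c).map_iSup f

theorem coe_add_iInf {ι : Sort*} (c : ℝ) (f : ι → EReal) :
    (c : EReal) + ⨅ i, f i = ⨅ i, ((c : EReal) + f i) :=
  (addCoeIso c).map_iInf f

theorem coe_add_inf (c : ℝ) (x y : EReal) :
    (c : EReal) + (x ⊓ y) = ((c : EReal) + x) ⊓ ((c : EReal) + y) :=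
  (addCoeIso c).map_inf x y

theorem continuous_coe_add (c : ℝ) : Continuous fun x : EReal => (c : EReal) + x :=
  (addCoeIso c).continuous

/-- Order-preserving, additively homogeneous, continuous self-maps that preserve `ℝⁿ`. -/
structure IsTopical {n : ℕ} (f : (Fin n → EReal) → (Fin n → EReal)) : Prop where
  mono : Monotone f
  homog : ∀ (c : ℝ) (x : Fin n → EReal) (j : Fin n), f (fun i => c + x i) j = c + f x j
  cont : Continuous f
  real : ∀ (x : Fin n → ℝ) (j : Fin n),
    f (fun i => (x i : EReal)) j ≠ ⊥ ∧ f (fun i => (x i : EReal)) j ≠ ⊤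

/-! ### Eigenvalues of topical maps by vanishing discount. -/

namespace IsTopical

variable {n : ℕ} {f : (Fin n → EReal) → (Fin n → EReal)}

/-- The restriction of a topical map to `ℝⁿ`. -/
def restrict (f : (Fin n → EReal) → (Fin n → EReal)) (x : Fin n → ℝ) : Fin n → ℝ :=
  fun j => (f (fun i => (x i : EReal)) j).toReal

theorem coe_restrict (hf : IsTopical f) (x : Fin n → ℝ) (j : Fin n) :
    (restrict f x j : EReal) = f (fun i => (x i : EReal)) j :=
  EReal.coe_toReal (hf.real x j).2 (hf.real x j).1

theorem le_coe_add_restrict (hf : IsTopical f) {x : Fin n → EReal} {y : Fin n → ℝ} {d : ℝ}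
    (h : ∀ i, x i ≤ ((d + y i : ℝ) : EReal)) (j : Fin n) :
    f x j ≤ ((d + restrict f y j : ℝ) : EReal) := by
  rw [EReal.coe_add, hf.coe_restrict, ← hf.homog]
  exact hf.mono (fun i => by simpa using h i) j

theorem restrict_le_add (hf : IsTopical f) {x y : Fin n → ℝ} {d : ℝ}
    (h : ∀ i, x i ≤ d + y i) (j : Fin n) : restrict f x j ≤ d + restrict f y j := by
  rw [← EReal.coe_le_coe_iff, hf.coe_restrict]
  exact hf.le_coe_add_restrict (fun i => EReal.coe_le_coe_iff.2 (h i)) j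

/-- Monotonicity and homogeneity make `restrict f` nonexpansive in the sup norm, so the factor `a <
1` gives a contraction and Banach's theorem applies. -/
theorem exists_discounted (hf : IsTopical f) {a : ℝ} (ha0 : 0 ≤ a) (ha1 : a < 1) :
    ∃ x : Fin n → ℝ, ∀ j, restrict f (fun i => a * x i) j = x j := by
  have key : ContractingWith ⟨a, ha0⟩ (fun x : Fin n → ℝ => restrict f (fun i => a * x i)) := by
    refine ⟨by exact_mod_cast ha1, LipschitzWith.of_dist_le_mul fun x y => ?_⟩
    change _ ≤ a * dist x y
    have hxy : ∀ x y : Fin n → ℝ, ∀ j,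
        restrict f (fun i => a * x i) j ≤ a * dist x y + restrict f (fun i => a * y i) j := by
      intro x y
      refine hf.restrict_le_add fun i => ?_
      have h1 : x i - y i ≤ dist x y :=
        (le_abs_self _).trans ((Real.dist_eq (x i) (y i)).symm.le.trans (dist_le_pi_dist x y i))
      nlinarith
    rw [dist_pi_le_iff (by positivity)]
    intro j
    rw [Real.dist_eq, abs_le]
    have h1 := hxy x y j
    have h2 := hxy y x j
    rw [dist_comm y x] at h2
    constructor <;> linarith
  exact ⟨_, fun j => congrFun key.fixedPoint_isFixedPt j⟩

/-- Discounted fixed points, shifted to have maximum 0, lie in a compact set of extended vectors.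
Any limit is an eigenvector for `μ = lim (1 - a k) * max (x k)`. A sub-eigenvalue `ν` is at most
each `v k`, hence at most the limit. -/
theorem exists_greatest_eigenvalue (hf : IsTopical f) (hn : 0 < n) :
    ∃ μ : ℝ, (∃ y : Fin n → EReal, (∀ j, y j ≠ ⊤) ∧ (∃ j, y j ≠ ⊥) ∧
      ∀ j, (μ : EReal) + y j = f y j) ∧
      ∀ (ν : ℝ) (x : Fin n → EReal), (∀ j, x j ≠ ⊤) → (∃ j, x j ≠ ⊥) →
        (∀ j, (ν : EReal) + x j ≤ f x j) → ν ≤ μ := by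
  have : Nonempty (Fin n) := ⟨⟨0, hn⟩⟩
  let a : ℕ → ℝ := fun k => 1 - 1 / ((k : ℝ) + 1)
  have hpos : ∀ k : ℕ, 0 < 1 / ((k : ℝ) + 1) := fun k => by positivity
  have ha0 : ∀ k, 0 ≤ a k := fun k => by
    have : 1 / ((k : ℝ) + 1) ≤ 1 := by
      rw [div_le_one (by positivity)]
      linarith [(Nat.cast_nonneg k : (0 : ℝ) ≤ k)]
    simp only [a]; linarith
  have ha1 : ∀ k, a k < 1 := fun k => by have := hpos k; simp only [a]; linarith
  have hat : Tendsto a atTop (𝓝 1) := by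
    have := (tendsto_const_nhds (x := (1 : ℝ))).sub
      (tendsto_one_div_add_atTop_nhds_zero_nat (𝕜 := ℝ))
    rwa [sub_zero] at this
  choose x hx using fun k => hf.exists_discounted (ha0 k) (ha1 k)
  choose J hJ using fun k => Finite.exists_max (x k)
  let v : ℕ → ℝ := fun k => (1 - a k) * x k (J k)
  let y : ℕ → Fin n → ℝ := fun k j => x k j - x k (J k)
  have hy0 : ∀ k j, y k j ≤ 0 := fun k j => sub_nonpos.2 (hJ k j)
  have hyf : ∀ k j, restrict f (fun i => a k * y k i) j = v k + y k j := by
    intro k j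
    apply le_antisymm
    · have := hf.restrict_le_add (x := fun i => a k * y k i) (y := fun i => a k * x k i)
        (d := -(a k * x k (J k))) (fun i => by simp only [y]; linarith) j
      rw [hx] at this
      simp only [v, y]; linarith
    · have := hf.restrict_le_add (y := fun i => a k * y k i) (x := fun i => a k * x k i)
        (d := a k * x k (J k)) (fun i => by simp only [y]; linarith) j
      rw [hx] at this
      simp only [v, y]; linarith
  obtain ⟨C, hC⟩ : ∃ C : ℝ, ∀ j, |restrict f (fun _ => 0) j| ≤ C := by
    obtain ⟨j, hj⟩ := Finite.exists_max fun j => |restrict f (fun _ => 0) j|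
    exact ⟨_, hj⟩
  have hv : ∀ k, v k ∈ Icc (-C) C := by
    intro k
    constructor
    -- Comparison with the zero vector at a minimal coordinate bounds `(1 - a k) * min (x k)` below
    -- by `-C`, and the maximum is larger.
    · obtain ⟨j, hj⟩ := Finite.exists_min (x k)
      have h1 := hf.restrict_le_add (x := fun _ => 0) (y := fun i => a k * x k i)
        (d := -(a k * x k j)) (fun i => by nlinarith [hj i, ha0 k]) j
      rw [hx] at h1
      have h2 := (abs_le.1 (hC j)).1
      have h3 := hJ k j
      have h4 := ha1 k
      simp only [v]
      nlinarith
    · have h1 := hf.restrict_le_add (x := fun i => a k * y k i) (y := fun _ => 0) (d := 0)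
        (fun i => by nlinarith [hy0 k i, ha0 k]) (J k)
      rw [hyf] at h1
      have h2 := (abs_le.1 (hC (J k))).2
      simp only [y, sub_self] at h1
      linarith
  let U : Ultrafilter ℕ := hyperfilter ℕ
  have hU : (U : Filter ℕ) ≤ atTop := by
    rw [← Nat.cofinite_eq_atTop]; exact hyperfilter_le_cofinite
  obtain ⟨μ, -, hμ⟩ := (isCompact_Icc (a := -C) (b := C)).ultrafilter_le_nhds (U.map v)
    (le_principal_iff.2 (Filter.mem_map.2 (Filter.univ_mem' hv)))
  have hμ : Tendsto v U (𝓝 μ) := hμ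
  let K : Set (Fin n → EReal) := {z | (∀ j, z j ≤ 0) ∧ ∃ j, z j = 0}
  have hK : IsClosed K := by
    have : K = (⋂ j, {z | z j ≤ 0}) ∩ ⋃ j, {z | z j = 0} := by ext z; simp [K]
    rw [this]
    exact (isClosed_iInter fun j => isClosed_le (continuous_apply j) continuous_const).inter
      (isClosed_iUnion_of_finite fun j => isClosed_eq (continuous_apply j) continuous_const)
  let yE : ℕ → Fin n → EReal := fun k j => (y k j : EReal)
  have hyK : ∀ k, yE k ∈ K := fun k =>
    ⟨fun j => EReal.coe_nonpos.2 (hy0 k j), J k, by simp [yE, y]⟩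
  obtain ⟨z, hzK, hz⟩ := hK.isCompact.ultrafilter_le_nhds (U.map yE)
    (le_principal_iff.2 (Filter.mem_map.2 (Filter.univ_mem' hyK)))
  have hz : Tendsto yE U (𝓝 z) := hz
  have hzj : ∀ j, Tendsto (fun k => yE k j) U (𝓝 (z j)) := fun j => tendsto_pi_nhds.1 hz j
  have hztop : ∀ j, z j ≠ ⊤ := fun j h => by have := hzK.1 j; rw [h] at this; simp at this
  refine ⟨μ, ⟨z, hztop, ?_, fun j => ?_⟩, ?_⟩
  · obtain ⟨j, hj⟩ := hzK.2
    exact ⟨j, by rw [hj]; exact EReal.zero_ne_bot⟩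
  · have haE : Tendsto (fun k => (a k : EReal)) U (𝓝 ((1 : ℝ) : EReal)) :=
      EReal.tendsto_coe.2 (hat.mono_left hU)
    have h1 : Tendsto (fun k => (fun i => ((a k * y k i : ℝ) : EReal))) U (𝓝 z) := by
      refine tendsto_pi_nhds.2 fun i => ?_
      -- The limit `z i` may be `⊥`; the product is still continuous there because the other factor
      -- tends to 1, finite and nonzero.
      have := EReal.Tendsto.mul haE (hzj i) (.inl (by simp)) (.inl (by simp))
        (.inl (EReal.coe_ne_bot 1)) (.inl (EReal.coe_ne_top 1))
      simpa [yE] using this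
    have h2 : Tendsto (fun k => f (fun i => ((a k * y k i : ℝ) : EReal)) j) U (𝓝 (f z j)) :=
      ((continuous_apply j).comp hf.cont).continuousAt.tendsto.comp h1
    have h3 : Tendsto (fun k => (v k : EReal) + yE k j) U (𝓝 ((μ : EReal) + z j)) :=
      (EReal.continuousAt_add (p := ((μ : EReal), z j)) (by simp) (by simp)).tendsto.comp
        ((EReal.tendsto_coe.2 hμ).prodMk_nhds (hzj j))
    refine tendsto_nhds_unique h3 (h2.congr fun k => ?_)
    rw [← hf.coe_restrict (fun i => a k * y k i) j, hyf, EReal.coe_add]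
  · intro ν w hwt ⟨j0, hj0⟩ hw
    refine ge_of_tendsto' hμ fun k => ?_
    obtain ⟨jm, hjm⟩ := Finite.exists_max w
    have hmb : w jm ≠ ⊥ := fun h => hj0 (le_bot_iff.1 (h ▸ hjm j0))
    obtain ⟨M, hM⟩ : ∃ M : ℝ, w jm = M := ⟨_, (EReal.coe_toReal (hwt jm) hmb).symm⟩
    obtain ⟨js, hjs⟩ := Finite.exists_max fun j => ((-x k j : ℝ) : EReal) + w j
    have hsb : w js ≠ ⊥ := by
      intro h
      have := hjs jm
      rw [h, hM, EReal.add_bot, ← EReal.coe_add] at this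
      exact EReal.coe_ne_bot _ (le_bot_iff.1 this)
    obtain ⟨S, hS⟩ : ∃ S : ℝ, w js = S := ⟨_, (EReal.coe_toReal (hwt js) hsb).symm⟩
    -- `d` is the largest gap `w - x k` after `w` is normalised to have maximum 0. Then `w - M` is
    -- below both 0 and `d + x k`, hence below `a k * (d + x k)` whatever the sign. Applying `f` at
    -- `js` gives `ν ≤ -(1 - a k) * d`, while `d ≥ -max (x k)`.
    let d : ℝ := -x k js + S - M
    have hd : ∀ i, w i ≤ ((M + (a k * d + a k * x k i) : ℝ) : EReal) := by
      intro i
      by_cases hb : w i = ⊥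
      · rw [hb]; exact bot_le
      obtain ⟨W, hW⟩ : ∃ W : ℝ, w i = W := ⟨_, (EReal.coe_toReal (hwt i) hb).symm⟩
      have h1 := hjs i
      have h2 := hjm i
      rw [hW, hS] at h1
      rw [hW, hM] at h2
      rw [hW]
      norm_cast at h1 h2 ⊢
      have h3 : W - M ≤ d + x k i := by simp only [d]; linarith
      have h4 := ha0 k
      have h5 := ha1 k
      rcases le_total 0 (d + x k i) with h | h <;> nlinarith
    have h1 := (hw js).trans (hf.le_coe_add_restrict (x := w) (y := fun i => a k * x k i)
      (d := M + a k * d) (fun i => by simpa only [add_assoc] using hd i) js)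
    rw [hx, hS] at h1
    norm_cast at h1
    have h2 := hjs jm
    rw [hS, hM] at h2
    norm_cast at h2
    have h3 := hJ k jm
    have h4 := ha1 k
    have h5 : 0 ≤ d + x k (J k) := by simp only [d]; linarith
    have h6 : ν + (1 - a k) * d ≤ 0 := by simp only [d] at h1 ⊢; linarith
    simp only [v]
    nlinarith

/-- Identifies the supremum `specRadius f` with the real eigenvalue just built; an eigenvalue `⊥`
cannot exceed it. -/
theorem exists_isGreatest_eigenvalues (hf : IsTopical f) (hn : 0 < n) :
    ∃ μ : ℝ, specRadius f = μ ∧ (∃ y : Fin n → EReal, (∀ j, y j ≠ ⊤) ∧ (∃ j, y j ≠ ⊥) ∧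
      ∀ j, (μ : EReal) + y j = f y j) ∧
      ∀ (ν : ℝ) (x : Fin n → EReal), (∀ j, x j ≠ ⊤) → (∃ j, x j ≠ ⊥) →
        (∀ j, (ν : EReal) + x j ≤ f x j) → ν ≤ μ := by
  obtain ⟨μ, hy, hmax⟩ := hf.exists_greatest_eigenvalue hn
  refine ⟨μ, le_antisymm (sSup_le ?_) (le_sSup ⟨EReal.coe_ne_top _, hy⟩), hy, hmax⟩
  rintro ν ⟨hνt, x, hxt, hxb, hx⟩
  by_cases hb : ν = ⊥
  · rw [hb]; exact bot_le
  lift ν to ℝ using ⟨hνt, hb⟩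
  exact EReal.coe_le_coe_iff.2 (hmax ν x hxt hxb fun j => (hx j).le)

end IsTopical

/-! ### Max-plus maps, their residuals, and `h_λ` as a topical map. -/

section Operators

variable {m n : ℕ} {A B : Matrix (Fin m) (Fin n) EReal}

theorem act_mono (A : Matrix (Fin m) (Fin n) EReal) : Monotone (act A) :=
  fun _ _ h _ => iSup_mono fun j => add_le_add_right (h j) _

theorem act_homog (A : Matrix (Fin m) (Fin n) EReal) (c : ℝ) (x : Fin n → EReal) (i : Fin m) :
    act A (fun j => c + x j) i = c + act A x i := by
  simp only [act, coe_add_iSup]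
  exact iSup_congr fun j => add_left_comm _ _ _

theorem continuous_act (hA : IsMaxPlus A) : Continuous (act A) := by
  refine continuous_pi fun i => ?_
  simp only [act, ← Finset.sup_univ_eq_iSup]
  refine Continuous.finset_sup_apply fun j _ => ?_
  by_cases hb : A i j = ⊥
  · simp only [hb, EReal.bot_add]; exact continuous_const
  · have h := EReal.coe_toReal (hA i j) hb
    rw [← h]
    exact (continuous_coe_add _).comp (continuous_apply j)

theorem exists_act_eq (hn : 0 < n) (A : Matrix (Fin m) (Fin n) EReal) (x : Fin n → EReal)
    (i : Fin m) : ∃ k, act A x i = A i k + x k := by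
  have : Nonempty (Fin n) := ⟨⟨0, hn⟩⟩
  obtain ⟨k, hk⟩ := exists_eq_ciSup_of_finite (f := fun j => A i j + x j)
  exact ⟨k, hk.symm⟩

theorem le_act (A : Matrix (Fin m) (Fin n) EReal) (x : Fin n → EReal) (i : Fin m) (k : Fin n) :
    A i k + x k ≤ act A x i :=
  le_iSup (fun j => A i j + x j) k

theorem act_ne_top (hn : 0 < n) (hA : IsMaxPlus A) {x : Fin n → EReal} (hx : ∀ j, x j ≠ ⊤)
    (i : Fin m) : act A x i ≠ ⊤ := by
  obtain ⟨k, hk⟩ := exists_act_eq hn A x i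
  rw [hk]
  exact EReal.add_ne_top (hA i k) (hx k)

theorem act_ne_bot {x : Fin n → EReal} {i : Fin m} {k : Fin n} (hA : A i k ≠ ⊥) (hx : x k ≠ ⊥) :
    act A x i ≠ ⊥ :=
  fun h => (EReal.add_ne_bot_iff.2 ⟨hA, hx⟩) (le_bot_iff.1 (h ▸ le_act A x i k))

theorem residuated_mono (A : Matrix (Fin m) (Fin n) EReal) : Monotone (residuated A) :=
  fun _ _ h _ => iInf₂_mono fun i _ => add_le_add_right (h i) _

theorem residuated_homog (A : Matrix (Fin m) (Fin n) EReal) (c : ℝ) (y : Fin m → EReal)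
    (j : Fin n) : residuated A (fun i => c + y i) j = c + residuated A y j := by
  simp only [residuated, coe_add_iInf]
  exact iInf_congr fun i => iInf_congr fun _ => add_left_comm _ _ _

theorem continuous_residuated (hA : IsMaxPlus A) : Continuous (residuated A) := by
  refine continuous_pi fun j => ?_
  have h : (fun y : Fin m → EReal => residuated A y j) =
      fun y => Finset.univ.inf fun i => ⨅ _ : A i j ≠ ⊥, -A i j + y i := by
    funext y
    exact (Finset.inf_univ_eq_iInf _).symm
  rw [h]
  refine Continuous.finset_inf_apply fun i _ => ?_
  by_cases hb : A i j = ⊥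
  · simp only [hb, ne_eq, not_true_eq_false, iInf_false]; exact continuous_const
  · have h := EReal.coe_toReal (hA i j) hb
    simp only [hb, ne_eq, not_false_eq_true, iInf_true]
    rw [← h, ← EReal.coe_neg]
    exact (continuous_coe_add _).comp (continuous_apply i)

theorem residuated_le {i : Fin m} {j : Fin n} (h : A i j ≠ ⊥) (y : Fin m → EReal) :
    residuated A y j ≤ -A i j + y i :=
  iInf₂_le i h

theorem exists_residuated_eq {j : Fin n} (hj : ∃ i, A i j ≠ ⊥) (y : Fin m → EReal) :
    ∃ i, A i j ≠ ⊥ ∧ residuated A y j = -A i j + y i := by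
  have : Nonempty {i // A i j ≠ ⊥} := let ⟨i, hi⟩ := hj; ⟨⟨i, hi⟩⟩
  obtain ⟨⟨i, hi⟩, h⟩ := exists_eq_ciInf_of_finite (f := fun i : {i // A i j ≠ ⊥} => -A i j + y i)
  refine ⟨i, hi, ?_⟩
  rw [residuated, iInf_subtype', ← h]

theorem residuated_eq_top {j : Fin n} (hj : ¬ ∃ i, A i j ≠ ⊥) (y : Fin m → EReal) :
    residuated A y j = ⊤ := by
  simp only [residuated, iInf_eq_top]
  exact fun i hi => (hj ⟨i, hi⟩).elim

theorem resComp_mono (A B : Matrix (Fin m) (Fin n) EReal) : Monotone (resComp A B) :=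
  fun _ _ h => residuated_mono A (act_mono B h)

theorem resComp_homog (A B : Matrix (Fin m) (Fin n) EReal) (c : ℝ) (x : Fin n → EReal)
    (j : Fin n) : resComp A B (fun j => c + x j) j = c + resComp A B x j := by
  rw [resComp, resComp, ← residuated_homog]
  congr 1
  funext i
  exact act_homog B c x i

theorem continuous_resComp (hA : IsMaxPlus A) (hB : IsMaxPlus B) : Continuous (resComp A B) :=
  (continuous_residuated hA).comp (continuous_act hB)

/-- The value of one move of Min in row `i` from column `j`. -/
theorem coe_neg_add_act {i : Fin m} {j : Fin n} (hA : IsMaxPlus A) (hij : A i j ≠ ⊥) (y : EReal) :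
    -A i j + y = ((-(A i j).toReal : ℝ) : EReal) + y := by
  rw [EReal.coe_neg, EReal.coe_toReal (hA i j) hij]

theorem coe_add_ne_bot {c : ℝ} {x : EReal} : (c : EReal) + x ≠ ⊥ ↔ x ≠ ⊥ := by
  simp

theorem coe_add_ne_top {c : ℝ} {x : EReal} (hx : x ≠ ⊤) : (c : EReal) + x ≠ ⊤ :=
  EReal.add_ne_top (EReal.coe_ne_top c) hx

theorem resComp_coe_ne_bot (hA : IsMaxPlus A) (hrB : NoBotRow B)
    (x : Fin n → ℝ) (j : Fin n) : resComp A B (fun i => (x i : EReal)) j ≠ ⊥ := by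
  by_cases hj : ∃ i, A i j ≠ ⊥
  · obtain ⟨i, hi, h⟩ := exists_residuated_eq hj (act B (fun i => (x i : EReal)))
    obtain ⟨k, hk⟩ := hrB i
    rw [resComp, h, coe_neg_add_act hA hi, coe_add_ne_bot]
    exact act_ne_bot hk (EReal.coe_ne_bot _)
  · rw [resComp, residuated_eq_top hj]
    exact top_ne_bot

theorem resComp_ne_top (hn : 0 < n) (hA : IsMaxPlus A) (hB : IsMaxPlus B) {j : Fin n}
    (hj : ∃ i, A i j ≠ ⊥) {x : Fin n → EReal} (hx : ∀ j, x j ≠ ⊤) : resComp A B x j ≠ ⊤ := by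
  obtain ⟨i, hi, h⟩ := exists_residuated_eq hj (act B x)
  rw [resComp, h, coe_neg_add_act hA hi]
  exact coe_add_ne_top (act_ne_top hn hB hx i)

theorem isTopical_resComp (hn : 0 < n) (hA : IsMaxPlus A) (hB : IsMaxPlus B) (hrB : NoBotRow B)
    (hcA : NoBotCol A) : IsTopical (resComp A B) where
  mono := resComp_mono A B
  homog := resComp_homog A B
  cont := continuous_resComp hA hB
  real x j := ⟨resComp_coe_ne_bot hA hrB x j,
    resComp_ne_top hn hA hB (hcA j) fun _ => EReal.coe_ne_top _⟩

theorem isTopical_hFun (hn : 0 < n) (hA : IsMaxPlus A) (hB : IsMaxPlus B) (hrA : NoBotRow A)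
    (hrB : NoBotRow B) (hc : NoCommonBotCol A B) (lam : ℝ) : IsTopical (hFun A B lam) where
  mono x y h j := inf_le_inf (add_le_add_right (resComp_mono A B h j) _)
    (add_le_add_right (resComp_mono B A h j) _)
  homog c x j := by
    simp only [hFun, resComp_homog, coe_add_inf]
    rw [add_left_comm, add_left_comm ((-lam : ℝ) : EReal)]
  cont := continuous_pi fun j =>
    ((continuous_coe_add lam).comp ((continuous_apply j).comp (continuous_resComp hA hB))).inf
      ((continuous_coe_add (-lam)).comp ((continuous_apply j).comp (continuous_resComp hB hA)))
  real x j := by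
    constructor
    · rcases min_choice ((lam : EReal) + resComp A B (fun i => (x i : EReal)) j)
        (((-lam : ℝ) : EReal) + resComp B A (fun i => (x i : EReal)) j) with h | h
      · rw [hFun, h, coe_add_ne_bot]; exact resComp_coe_ne_bot hA hrB x j
      · rw [hFun, h, coe_add_ne_bot]; exact resComp_coe_ne_bot hB hrA x j
    · obtain ⟨i, hi | hi⟩ := hc j
      · exact ne_top_of_le_ne_top
          (coe_add_ne_top (resComp_ne_top hn hA hB ⟨i, hi⟩ fun _ => EReal.coe_ne_top _))
          inf_le_left
      · exact ne_top_of_le_ne_top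
          (coe_add_ne_top (resComp_ne_top hn hB hA ⟨i, hi⟩ fun _ => EReal.coe_ne_top _))
          inf_le_right

theorem hFun_neg (A B : Matrix (Fin m) (Fin n) EReal) (lam : ℝ) :
    hFun A B (-lam) = hFun B A lam := by
  funext x j
  simp only [hFun, neg_neg]
  exact inf_comm _ _

theorem specFun_neg (A B : Matrix (Fin m) (Fin n) EReal) (lam : ℝ) :
    specFun A B (-lam) = specFun B A lam := by
  rw [specFun, hFun_neg, specFun]

/-- Min's optimal move from column `j`. If one matrix has only `⊥` in that column, its residual is
`⊤` and the other matrix supplies the minimum. -/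
theorem exists_hFun_eq (hA : IsMaxPlus A) (hB : IsMaxPlus B) (hc : NoCommonBotCol A B)
    (lam : ℝ) (x : Fin n → EReal) (j : Fin n) :
    (∃ i, A i j ≠ ⊥ ∧ hFun A B lam x j = ((lam - (A i j).toReal : ℝ) : EReal) + act B x i) ∨
    (∃ i, B i j ≠ ⊥ ∧ hFun A B lam x j = ((-lam - (B i j).toReal : ℝ) : EReal) + act A x i) := by
  have left : (∃ i, A i j ≠ ⊥) → hFun A B lam x j = (lam : EReal) + resComp A B x j →
      ∃ i, A i j ≠ ⊥ ∧ hFun A B lam x j = ((lam - (A i j).toReal : ℝ) : EReal) + act B x i := by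
    intro hj h
    obtain ⟨i, hi, hr⟩ := exists_residuated_eq hj (act B x)
    refine ⟨i, hi, ?_⟩
    rw [h, resComp, hr, coe_neg_add_act hA hi, ← add_assoc, ← EReal.coe_add, sub_eq_add_neg]
  have right : (∃ i, B i j ≠ ⊥) → hFun A B lam x j = ((-lam : ℝ) : EReal) + resComp B A x j →
      ∃ i, B i j ≠ ⊥ ∧ hFun A B lam x j = ((-lam - (B i j).toReal : ℝ) : EReal) + act A x i := by
    intro hj h
    obtain ⟨i, hi, hr⟩ := exists_residuated_eq hj (act A x)
    refine ⟨i, hi, ?_⟩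
    rw [h, resComp, hr, coe_neg_add_act hB hi, ← add_assoc, ← EReal.coe_add, sub_eq_add_neg]
  by_cases hjA : ∃ i, A i j ≠ ⊥
  · by_cases hjB : ∃ i, B i j ≠ ⊥
    · rcases min_choice ((lam : EReal) + resComp A B x j)
        (((-lam : ℝ) : EReal) + resComp B A x j) with h | h
      · exact .inl (left hjA h)
      · exact .inr (right hjB h)
    · refine .inl (left hjA ?_)
      rw [hFun, resComp.eq_1 B A, residuated_eq_top hjB, EReal.coe_add_top, inf_top_eq]
  · have hjB : ∃ i, B i j ≠ ⊥ := by
      obtain ⟨i, hi⟩ := hc j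
      exact ⟨i, hi.resolve_left fun h => hjA ⟨i, h⟩⟩
    refine .inr (right hjB ?_)
    rw [hFun, resComp.eq_1 A B, residuated_eq_top hjA, EReal.coe_add_top, top_inf_eq]

/-- One half of the residuation (Galois) correspondence between `A` and `A♯`. -/
theorem add_act_le_of_le_resComp (hA : IsMaxPlus A) {μ lam : ℝ} {x : Fin n → EReal}
    (h : ∀ j, (μ : EReal) + x j ≤ (lam : EReal) + resComp A B x j) (i : Fin m) :
    (μ : EReal) + act A x i ≤ (lam : EReal) + act B x i := by
  rw [act, coe_add_iSup]
  refine iSup_le fun j => ?_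
  by_cases hb : A i j = ⊥
  · rw [hb, EReal.bot_add, EReal.add_bot]; exact bot_le
  have h1 := (h j).trans (add_le_add_right (residuated_le hb (act B x)) _)
  rw [coe_neg_add_act hA hb, add_left_comm, le_coe_add_iff, neg_neg,
    EReal.coe_toReal (hA i j) hb, add_left_comm] at h1
  exact h1

/-- Sub-eigenvalues of `hFun A B lam` are nonpositive. -/
theorem nonpos_of_le_hFun (hn : 0 < n) (hA : IsMaxPlus A) (hB : IsMaxPlus B)
    (hc : NoCommonBotCol A B) {μ lam : ℝ} {x : Fin n → EReal} (hxt : ∀ j, x j ≠ ⊤)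
    (hxb : ∃ j, x j ≠ ⊥) (h : ∀ j, (μ : EReal) + x j ≤ hFun A B lam x j) : μ ≤ 0 := by
  obtain ⟨j, hj⟩ := hxb
  obtain ⟨i, hi⟩ := hc j
  have h1 := add_act_le_of_le_resComp hA (fun j => (h j).trans inf_le_left) i
  have h2 := add_act_le_of_le_resComp hB (fun j => (h j).trans inf_le_right) i
  have hAt := act_ne_top hn hA hxt i
  have hBt := act_ne_top hn hB hxt i
  -- One of the two values is finite by the choice of `i`; the inequalities transfer finiteness to
  -- the other, and their sum is then `2μ ≤ 0`.
  have hb : act A x i ≠ ⊥ ∧ act B x i ≠ ⊥ := by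
    rcases hi with hi | hi
    · have := act_ne_bot hi hj
      exact ⟨this, coe_add_ne_bot.1 (ne_bot_of_le_ne_bot (coe_add_ne_bot.2 this) h1)⟩
    · have := act_ne_bot hi hj
      exact ⟨coe_add_ne_bot.1 (ne_bot_of_le_ne_bot (coe_add_ne_bot.2 this) h2), this⟩
  rw [← EReal.coe_toReal hAt hb.1, ← EReal.coe_toReal hBt hb.2] at h1 h2
  norm_cast at h1 h2
  linarith

theorem hFun_lipschitz (A B : Matrix (Fin m) (Fin n) EReal) (lam lam' : ℝ) (x : Fin n → EReal)
    (j : Fin n) : ((-|lam - lam'| : ℝ) : EReal) + hFun A B lam x j ≤ hFun A B lam' x j := by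
  rw [hFun, coe_add_inf, ← add_assoc, ← add_assoc, ← EReal.coe_add, ← EReal.coe_add]
  refine inf_le_inf (add_le_add_left (EReal.coe_le_coe_iff.2 ?_) _)
    (add_le_add_left (EReal.coe_le_coe_iff.2 ?_) _)
  · linarith [le_abs_self (lam - lam')]
  · linarith [neg_abs_le (lam - lam')]

end Operators

/-! ### Cycles and cycle means. -/

/-- A self-map of `Fin n` that factors through `P` has, inside any nonempty invariant set, a cycle
of length at most `min n |P|`. -/
theorem exists_cycle {n : ℕ} {P : Type*} [Fintype P] (a : Fin n → P) (b : P → Fin n)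
    (S : Set (Fin n)) (hS : S.Nonempty) (hinv : ∀ j ∈ S, b (a j) ∈ S) :
    ∃ l : ℕ, 1 ≤ l ∧ l ≤ n ∧ l ≤ Fintype.card P ∧ ∃ c : ℕ → Fin n,
      (∀ r, c r ∈ S) ∧ (∀ r, c (r + 1) = b (a (c r))) ∧ c l = c 0 := by
  obtain ⟨j0, hj0⟩ := hS
  let φ : Fin n → Fin n := fun j => b (a j)
  have hmem : ∀ j ∈ S, ∀ k, φ^[k] j ∈ S := by
    intro j hj k
    induction k with
    | zero => exact hj
    | succ k ih => rw [Function.iterate_succ_apply']; exact hinv _ ih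
  obtain ⟨p, hpS, hp⟩ : ∃ p ∈ S, p ∈ Function.periodicPts φ := by
    obtain ⟨r, s, hne, hrs⟩ := Finite.exists_ne_map_eq_of_infinite fun k : ℕ => φ^[k] j0
    wlog hlt : r < s generalizing r s
    · exact this s r hne.symm hrs.symm (lt_of_le_of_ne (not_lt.1 hlt) hne.symm)
    refine ⟨φ^[r] j0, hmem _ hj0 r, s - r, Nat.sub_pos_of_lt hlt, ?_⟩
    change φ^[s - r] (φ^[r] j0) = φ^[r] j0
    rw [← Function.iterate_add_apply, Nat.sub_add_cancel hlt.le]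
    exact hrs.symm
  let l := Function.minimalPeriod φ p
  have hl : 0 < l := Function.minimalPeriod_pos_of_mem_periodicPts hp
  have hinj : InjOn (fun r => φ^[r] p) (Iio l) := Function.iterate_injOn_Iio_minimalPeriod
  -- Along the cycle, `a` determines the next point, and `φ^[l - 1]` recovers a point from its
  -- successor; so the values of `a` are distinct.
  have hinja : Function.Injective fun r : Fin l => a (φ^[r] p) := by
    intro r s hrs
    have h1 : φ^[r + 1] p = φ^[s + 1] p := by
      rw [Function.iterate_succ_apply', Function.iterate_succ_apply']
      exact congrArg b hrs
    have h2 : ∀ r : ℕ, φ^[l - 1] (φ^[r + 1] p) = φ^[r] p := by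
      intro r
      rw [← Function.iterate_add_apply, show l - 1 + (r + 1) = r + l by omega,
        Function.iterate_add_apply]
      exact congrArg _ Function.iterate_minimalPeriod
    have h3 := congrArg φ^[l - 1] h1
    rw [h2, h2] at h3
    exact Fin.ext (hinj r.2 s.2 h3)
  refine ⟨l, hl, ?_, ?_, fun r => φ^[r] p, hmem p hpS,
    fun r => Function.iterate_succ_apply' φ r p, Function.iterate_minimalPeriod⟩
  · have h : Function.Injective fun r : Fin l => φ^[r] p :=
      fun r s hrs => Fin.ext (hinj r.2 s.2 hrs)
    simpa using Fintype.card_le_of_injective _ h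
  · simpa using Fintype.card_le_of_injective _ hinja

/-- The means of at most `k` elements of `W`. -/
def means (W : Set ℝ) (k : ℕ) : Set ℝ :=
  {c | ∃ l : ℕ, 1 ≤ l ∧ l ≤ k ∧ ∃ w : Fin l → W, c = (∑ r, (w r : ℝ)) / l}

theorem means_finite {W : Set ℝ} (hW : W.Finite) (k : ℕ) : (means W k).Finite := by
  have := hW.to_subtype
  have h : (⋃ l ∈ Iic k, range fun w : Fin l → W => (∑ r, (w r : ℝ)) / l).Finite :=
    (finite_Iic k).biUnion fun l _ => finite_range _
  refine h.subset ?_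
  rintro c ⟨l, -, hl, w, rfl⟩
  exact mem_biUnion (show l ∈ Iic k from hl) ⟨w, rfl⟩

theorem abs_le_of_mem_means {W : Set ℝ} {D : ℝ} (hW : ∀ w ∈ W, |w| ≤ D) {k : ℕ} {c : ℝ}
    (hc : c ∈ means W k) : |c| ≤ D := by
  obtain ⟨l, hl, -, w, rfl⟩ := hc
  have hl' : (0 : ℝ) < l := by exact_mod_cast hl
  rw [abs_div, Nat.abs_cast, div_le_iff₀ hl']
  calc |∑ r, (w r : ℝ)| ≤ ∑ r, |(w r : ℝ)| := Finset.abs_sum_le_sum_abs _ _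
    _ ≤ ∑ _r : Fin l, D := Finset.sum_le_sum fun r _ => hW _ (w r).2
    _ = D * l := by simp [mul_comm]

/-- Potentials that change along a finite dynamical system by `±lam + w` force the drift to be the
mean of a cycle. -/
theorem exists_cycle_mean {n : ℕ} {Q : Type*} [Fintype Q] {S : Set (Fin n)} (hS : S.Nonempty)
    {W : Set ℝ} {μ lam : ℝ} {u : Fin n → ℝ} (b : Bool × Q → Fin n)
    (h : ∀ j ∈ S, ∃ p : Bool × Q, ∃ w ∈ W, b p ∈ S ∧
      μ + u j = (if p.1 then lam else -lam) + w + u (b p)) :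
    ∃ l q : ℕ, 1 ≤ l ∧ l ≤ min (2 * Fintype.card Q) n ∧ q ≤ l ∧
      ∃ c ∈ means W (min (2 * Fintype.card Q) n), μ = lam * (((l : ℝ) - 2 * q) / l) + c := by
  have : Nonempty (Bool × Q) := let ⟨j, hj⟩ := hS; let ⟨p, _⟩ := h j hj; ⟨p⟩
  choose! a w hwW hbS hμ using h
  obtain ⟨l, hl1, hln, hlP, c, hcS, hcs, hcl⟩ := exists_cycle a b S hS hbS
  have hlk : l ≤ min (2 * Fintype.card Q) n := by
    refine le_min ?_ hln
    simpa [Fintype.card_prod] using hlP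
  have hl0 : (0 : ℝ) < l := by exact_mod_cast hl1
  -- The number of steps of the cycle that carry `-lam`.
  let q := ((Finset.range l).filter fun r => (a (c r)).1 = false).card
  refine ⟨l, q, hl1, hlk, ?_, (∑ r : Fin l, w (c r)) / l,
    ⟨l, hl1, hlk, fun r => ⟨w (c r), hwW _ (hcS r)⟩, rfl⟩, ?_⟩
  · exact (Finset.card_filter_le _ _).trans (by simp)
  · have h1 : ∑ r ∈ Finset.range l, (μ + u (c r)) = ∑ r ∈ Finset.range l,
        ((if (a (c r)).1 then lam else -lam) + w (c r) + u (c (r + 1))) :=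
      Finset.sum_congr rfl fun r _ => by rw [hμ _ (hcS r), hcs]
    -- The potentials cancel because the cycle closes up.
    have h2 : ∑ r ∈ Finset.range l, u (c (r + 1)) = ∑ r ∈ Finset.range l, u (c r) := by
      have := Finset.sum_range_sub (fun r => u (c r)) l
      rw [hcl, sub_self, Finset.sum_sub_distrib] at this
      linarith
    have h3 : ∑ r ∈ Finset.range l, (if (a (c r)).1 then lam else -lam) = lam * (l - 2 * q) := by
      have : ∀ r, (if (a (c r)).1 then lam else -lam) =
          lam - 2 * lam * (if (a (c r)).1 = false then 1 else 0) := by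
        intro r
        cases (a (c r)).1
        · simp; ring
        · simp
      simp only [this, Finset.sum_sub_distrib, ← Finset.mul_sum, Finset.sum_boole,
        Finset.sum_const, Finset.card_range, nsmul_eq_mul]
      simp only [q]
      ring
    rw [Finset.sum_add_distrib, Finset.sum_add_distrib, Finset.sum_add_distrib, h2, h3,
      Finset.sum_const, Finset.card_range, nsmul_eq_mul,
      Finset.sum_range fun r => w (c r)] at h1
    field_simp
    linarith

/-! ### Entry differences and the bound `Δ`. -/

section Weights

variable {m n : ℕ} {A B : Matrix (Fin m) (Fin n) EReal}

/-- The differences between finite entries of `A` and `B` in a common row, with both signs. -/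
def weights (A B : Matrix (Fin m) (Fin n) EReal) : Set ℝ :=
  {w | ∃ i j k, A i j ≠ ⊥ ∧ B i k ≠ ⊥ ∧
    (w = (A i j).toReal - (B i k).toReal ∨ w = (B i k).toReal - (A i j).toReal)}

theorem weights_finite (A B : Matrix (Fin m) (Fin n) EReal) : (weights A B).Finite := by
  have h1 := finite_range fun p : Fin m × Fin n × Fin n =>
    (A p.1 p.2.1).toReal - (B p.1 p.2.2).toReal
  have h2 := finite_range fun p : Fin m × Fin n × Fin n =>
    (B p.1 p.2.2).toReal - (A p.1 p.2.1).toReal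
  refine (h1.union h2).subset ?_
  rintro w ⟨i, j, k, -, -, h | h⟩
  · exact .inl ⟨(i, j, k), h.symm⟩
  · exact .inr ⟨(i, j, k), h.symm⟩

/-- Max's replies `kA`, `kB` are fixed once per row, so the next column depends only on Min's choice
of sign and row. There are `2 * m` such choices, which gives the `2 * m` in the bound on cycle
lengths. Finite coordinates of `x` lead to finite coordinates. -/
theorem hFun_eigenvalue_eq (hn : 0 < n) (hA : IsMaxPlus A) (hB : IsMaxPlus B)
    (hc : NoCommonBotCol A B) {μ lam : ℝ} {x : Fin n → EReal} (hxt : ∀ j, x j ≠ ⊤)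
    (hxb : ∃ j, x j ≠ ⊥) (h : ∀ j, (μ : EReal) + x j = hFun A B lam x j) :
    ∃ l q : ℕ, 1 ≤ l ∧ l ≤ min (2 * m) n ∧ q ≤ l ∧
      ∃ c ∈ means (weights A B) (min (2 * m) n), μ = lam * (((l : ℝ) - 2 * q) / l) + c := by
  choose kA hkA using exists_act_eq hn A x
  choose kB hkB using exists_act_eq hn B x
  have key := exists_cycle_mean (Q := Fin m) (S := {j | x j ≠ ⊥}) hxb (W := weights A B) (μ := μ)
    (lam := lam) (u := fun j => (x j).toReal) (fun p => if p.1 then kB p.2 else kA p.2) ?_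
  · simpa only [Fintype.card_fin] using key
  intro j hj
  have hj : x j ≠ ⊥ := hj
  have real : ∀ {w : ℝ} {b : EReal} {k : Fin n}, b ≠ ⊤ → hFun A B lam x j = w + (b + x k) →
      b ≠ ⊥ ∧ x k ≠ ⊥ ∧ μ + (x j).toReal = w + (b.toReal + (x k).toReal) := by
    intro w b k hb hk
    rw [← h j] at hk
    have h1 : b + x k ≠ ⊥ := coe_add_ne_bot.1 (hk ▸ coe_add_ne_bot.2 hj)
    obtain ⟨h2, h3⟩ := EReal.add_ne_bot_iff.1 h1
    refine ⟨h2, h3, ?_⟩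
    rw [← EReal.coe_toReal hb h2, ← EReal.coe_toReal (hxt k) h3,
      ← EReal.coe_toReal (hxt j) hj] at hk
    exact_mod_cast hk
  rcases exists_hFun_eq hA hB hc lam x j with ⟨i, hi, hij⟩ | ⟨i, hi, hij⟩
  · rw [hkB] at hij
    obtain ⟨h1, h2, h3⟩ := real (hB i (kB i)) hij
    refine ⟨(true, i), _, ⟨i, j, kB i, hi, h1, .inr rfl⟩, by simpa using h2, ?_⟩
    simp only [if_true]
    linarith
  · rw [hkA] at hij
    obtain ⟨h1, h2, h3⟩ := real (hA i (kA i)) hij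
    refine ⟨(false, i), _, ⟨i, kA i, j, h1, hi, .inl rfl⟩, by simpa using h2, ?_⟩
    simp only [Bool.false_eq_true, if_false]
    linarith

theorem coe_sub_le_Cupper (hA : IsMaxPlus A) (hB : IsMaxPlus B) {i : Fin m} {j k : Fin n}
    (hj : A i j ≠ ⊥) (hk : B i k ≠ ⊥) :
    (((A i j).toReal - (B i k).toReal : ℝ) : EReal) ≤ Cupper A B := by
  rw [EReal.coe_sub, EReal.coe_toReal (hA i j) hj, EReal.coe_toReal (hB i k) hk]
  exact le_iSup_of_le i (le_iSup_of_le j (le_iSup_of_le k (le_iSup₂_of_le hj hk le_rfl)))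

theorem Clower_le_coe_sub (hA : IsMaxPlus A) (hB : IsMaxPlus B) {i : Fin m} {j k : Fin n}
    (hk : A i k ≠ ⊥) (hj : B i j ≠ ⊥) :
    Clower A B ≤ (((A i k).toReal - (B i j).toReal : ℝ) : EReal) := by
  rw [EReal.coe_sub, EReal.coe_toReal (hA i k) hk, EReal.coe_toReal (hB i j) hj]
  exact iInf_le_of_le i (iInf_le_of_le j (iInf_le_of_le k (iInf₂_le_of_le hk hj le_rfl)))

theorem Cupper_le_coe (hA : IsMaxPlus A) (hB : IsMaxPlus B) {C : ℝ}
    (h : ∀ i j k, A i j ≠ ⊥ → B i k ≠ ⊥ → (A i j).toReal - (B i k).toReal ≤ C) :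
    Cupper A B ≤ C := by
  refine iSup_le fun i => iSup_le fun j => iSup_le fun k => iSup₂_le fun hj hk => ?_
  rw [← EReal.coe_toReal (hA i j) hj, ← EReal.coe_toReal (hB i k) hk, ← EReal.coe_sub]
  exact EReal.coe_le_coe_iff.2 (h i j k hj hk)

/-- Rows that are not identically `⊥` provide a weight, so `Δ` is finite; weights occur with both
signs, so `Δ` bounds their absolute values and is nonnegative. -/
theorem exists_Delta_eq (hm : 0 < m) (hA : IsMaxPlus A) (hB : IsMaxPlus B) (hrA : NoBotRow A)
    (hrB : NoBotRow B) :
    ∃ D : ℝ, Delta A B = D ∧ 0 ≤ D ∧ ∀ w ∈ weights A B, |w| ≤ D := by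
  obtain ⟨C, hC⟩ : ∃ C, ∀ w ∈ weights A B, w ≤ C := (weights_finite A B).bddAbove
  have hup : Delta A B ≤ C := sup_le
    (Cupper_le_coe hA hB fun i j k hj hk => hC _ ⟨i, j, k, hj, hk, .inl rfl⟩)
    (Cupper_le_coe hB hA fun i j k hj hk => hC _ ⟨i, k, j, hk, hj, .inr rfl⟩)
  have hlow : ∀ w ∈ weights A B, (w : EReal) ≤ Delta A B := by
    rintro w ⟨i, j, k, hj, hk, rfl | rfl⟩
    · exact (coe_sub_le_Cupper hA hB hj hk).trans le_sup_left
    · exact (coe_sub_le_Cupper hB hA hk hj).trans le_sup_right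
  obtain ⟨j, hj⟩ := hrA ⟨0, hm⟩
  obtain ⟨k, hk⟩ := hrB ⟨0, hm⟩
  have hw := hlow _ ⟨_, j, k, hj, hk, .inl rfl⟩
  have hD : Delta A B = ((Delta A B).toReal : ℝ) :=
    (EReal.coe_toReal (ne_top_of_le_ne_top (EReal.coe_ne_top _) hup)
      (ne_bot_of_le_ne_bot (EReal.coe_ne_bot _) hw)).symm
  have habs : ∀ w ∈ weights A B, |w| ≤ (Delta A B).toReal := by
    rintro w ⟨i, j, k, hj, hk, h⟩
    have h1 := hlow _ ⟨i, j, k, hj, hk, .inl rfl⟩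
    have h2 := hlow _ ⟨i, j, k, hj, hk, .inr rfl⟩
    rw [hD, EReal.coe_le_coe_iff] at h1 h2
    rcases h with rfl | rfl <;> rw [abs_le] <;> constructor <;> linarith
  exact ⟨_, hD, (abs_nonneg _).trans (habs _ ⟨_, j, k, hj, hk, .inl rfl⟩), habs⟩

theorem weights_comm (A B : Matrix (Fin m) (Fin n) EReal) : weights A B = weights B A := by
  ext w
  constructor <;> exact fun ⟨i, j, k, hj, hk, h⟩ => ⟨i, k, j, hk, hj, h.symm⟩

/-- At a largest coordinate of `x`, the move through row `i` to column `k` gains at most one weight,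
and `x k ≤ x j`. -/
theorem resComp_eigenvalue_le (hn : 0 < n) (hA : IsMaxPlus A) (hB : IsMaxPlus B)
    (hcA : NoBotCol A) {D : ℝ} (hD : ∀ w ∈ weights A B, |w| ≤ D) {μ : ℝ} {x : Fin n → EReal}
    (hxt : ∀ j, x j ≠ ⊤) (hxb : ∃ j, x j ≠ ⊥)
    (h : ∀ j, (μ : EReal) + x j ≤ resComp A B x j) : μ ≤ D := by
  have : Nonempty (Fin n) := ⟨⟨0, hn⟩⟩
  obtain ⟨j, hj⟩ := Finite.exists_max x
  have hjb : x j ≠ ⊥ := let ⟨j0, hj0⟩ := hxb; ne_bot_of_le_ne_bot hj0 (hj j0)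
  obtain ⟨i, hi⟩ := hcA j
  obtain ⟨k, hk⟩ := exists_act_eq hn B x i
  have h1 := (h j).trans (residuated_le hi (act B x))
  rw [hk, coe_neg_add_act hA hi] at h1
  have h2 := coe_add_ne_bot.1 (ne_bot_of_le_ne_bot (coe_add_ne_bot.2 hjb) h1)
  obtain ⟨hb, hxk⟩ := EReal.add_ne_bot_iff.1 h2
  have h3 := hj k
  rw [← EReal.coe_toReal (hB i k) hb, ← EReal.coe_toReal (hxt k) hxk,
    ← EReal.coe_toReal (hxt j) hjb] at h1
  rw [← EReal.coe_toReal (hxt k) hxk, ← EReal.coe_toReal (hxt j) hjb] at h3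
  norm_cast at h1 h3
  have h4 := (abs_le.1 (hD _ ⟨i, j, k, hi, hb, .inr rfl⟩)).2
  linarith

end Weights

/-! ### Finite families of lines that do not cross. -/

/-- A continuous function that agrees at every point with one of finitely many affine functions,
whose graphs do not cross below `T`, is affine below `T`. -/
theorem exists_affine_of_finite {f : ℝ → ℝ} (hf : Continuous f) {F : Set (ℝ × ℝ)} (hF : F.Finite)
    {T : ℝ} (h : ∀ x < T, ∃ p ∈ F, f x = x * p.1 + p.2)
    (hne : ∀ p ∈ F, ∀ p' ∈ F, ∀ x < T, x * p.1 + p.2 = x * p'.1 + p'.2 → p = p') :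
    ∃ p ∈ F, ∀ x ≤ T, f x = x * p.1 + p.2 := by
  obtain ⟨p, hp, hpx⟩ := h (T - 1) (by linarith)
  have hcl : ∀ p : ℝ × ℝ, IsClosed {x | f x = x * p.1 + p.2} := fun p =>
    isClosed_eq hf (by fun_prop)
  have hlt : ∀ x < T, f x = x * p.1 + p.2 := by
    by_contra! hcon
    obtain ⟨x, hx, hxp⟩ := hcon
    have hcl' : IsClosed (⋃ p' ∈ F \ {p}, {x | f x = x * p'.1 + p'.2}) :=
      hF.sdiff.isClosed_biUnion fun p' _ => hcl p'
    have hcov : ∀ y < T, f y ≠ y * p.1 + p.2 →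
        y ∈ ⋃ p' ∈ F \ {p}, {x | f x = x * p'.1 + p'.2} := by
      intro y hy hyp
      obtain ⟨p', hp', hyp'⟩ := h y hy
      refine mem_biUnion (show p' ∈ F \ {p} from ⟨hp', ?_⟩) hyp'
      rintro rfl
      exact hyp hyp'
    -- The half-line is covered by two closed sets, the points on line `p` and those on another
    -- line; if both are met, they share a point, which is a forbidden crossing.
    obtain ⟨y, hy, hyp, hyp'⟩ := isPreconnected_closed_iff.1 (isPreconnected_Iio (a := T)) _ _
      (hcl p) hcl' (fun y hy => or_iff_not_imp_left.2 (hcov y hy))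
      ⟨T - 1, by simp, hpx⟩ ⟨x, hx, hcov x hx hxp⟩
    obtain ⟨p', hp', hyp'⟩ := mem_iUnion₂.1 hyp'
    exact hp'.2 (hne p' hp'.1 p hp y hy (hyp'.symm.trans hyp))
  refine ⟨p, hp, fun x hx => ?_⟩
  have : closure (Iio T) ⊆ {x | f x = x * p.1 + p.2} := closure_minimal hlt (hcl p)
  rw [closure_Iio] at this
  exact this hx

theorem nonneg_slope_of_nonpos {σ c T : ℝ} (h : ∀ x ≤ T, x * σ + c ≤ 0) : 0 ≤ σ := by
  -- A line of negative slope is at least 1 to the left of `(1 - c) / σ`.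
  by_contra! hσ
  have h1 := h (min T ((1 - c) / σ)) (min_le_left _ _)
  have h2 : (1 - c) / σ * σ = 1 - c := div_mul_cancel₀ _ hσ.ne
  nlinarith [min_le_right T ((1 - c) / σ)]

/-- The affine functions that describe cycle means of length at most `k`. -/
def cycleLines (K : Set ℝ) (k : ℕ) : Set (ℝ × ℝ) :=
  {p | (∃ l q : ℕ, 1 ≤ l ∧ l ≤ k ∧ q ≤ l ∧ p.1 = ((l : ℝ) - 2 * q) / l) ∧ p.2 ∈ K}

theorem cycleLines_finite {K : Set ℝ} (hK : K.Finite) (k : ℕ) : (cycleLines K k).Finite := by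
  have h : ((fun lq : ℕ × ℕ => ((lq.1 : ℝ) - 2 * lq.2) / lq.1) '' (Iic k ×ˢ Iic k)).Finite :=
    ((finite_Iic k).prod (finite_Iic k)).image _
  refine (h.prod hK).subset ?_
  rintro p ⟨⟨l, q, -, hl, hq, hp⟩, hpK⟩
  exact ⟨⟨(l, q), ⟨hl, hq.trans hl⟩, hp.symm⟩, hpK⟩

/-- Two distinct slopes differ by a nonzero integer over `l * l'`, hence by at least `1 / k ^ 2`,
while intercepts differ by at most `2 * D`. A crossing therefore has `|x| ≤ 2 * k ^ 2 * D`. -/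
theorem cycleLines_not_cross {K : Set ℝ} {D : ℝ} (hD : ∀ c ∈ K, |c| ≤ D) {k : ℕ}
    {p p' : ℝ × ℝ} (hp : p ∈ cycleLines K k) (hp' : p' ∈ cycleLines K k) {x : ℝ}
    (hx : x < -(2 * (k : ℝ) ^ 2 * D)) (h : x * p.1 + p.2 = x * p'.1 + p'.2) : p = p' := by
  obtain ⟨⟨l, q, hl1, hlk, -, hσ⟩, hc⟩ := hp
  obtain ⟨⟨l', q', hl1', hlk', -, hσ'⟩, hc'⟩ := hp'
  have hD0 : 0 ≤ D := (abs_nonneg _).trans (hD _ hc)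
  suffices hs : p.1 = p'.1 by
    refine Prod.ext hs ?_
    rw [hs] at h
    linarith
  by_contra hne
  have hl0 : (0 : ℝ) < l := by exact_mod_cast hl1
  have hl0' : (0 : ℝ) < l' := by exact_mod_cast hl1'
  have hlk : (l : ℝ) ≤ k := by exact_mod_cast hlk
  have hlk' : (l' : ℝ) ≤ k := by exact_mod_cast hlk'
  let N : ℤ := ((l : ℤ) - 2 * q) * l' - ((l' : ℤ) - 2 * q') * l
  have hN : (p.1 - p'.1) * (l * l') = (N : ℝ) := by
    rw [hσ, hσ']
    simp only [N]
    push_cast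
    field_simp
  have hN0 : N ≠ 0 := by
    intro h0
    rw [h0, Int.cast_zero] at hN
    rcases mul_eq_zero.1 hN with h | h
    · exact hne (sub_eq_zero.1 h)
    · exact (mul_pos hl0 hl0').ne' h
  have hN1 : (1 : ℝ) ≤ |(N : ℝ)| := by exact_mod_cast Int.one_le_abs hN0
  have hx0 : x ≤ 0 := by
    have : 0 ≤ 2 * (k : ℝ) ^ 2 * D := by positivity
    linarith
  have h1 : x * (N : ℝ) = (p'.2 - p.2) * (l * l') := by
    rw [← hN, show p'.2 - p.2 = x * (p.1 - p'.1) by linarith]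
    ring
  have h2 : |x| * |(N : ℝ)| = |p'.2 - p.2| * (l * l') := by
    rw [← abs_mul, h1, abs_mul, abs_of_pos (mul_pos hl0 hl0')]
  have h3 : |p'.2 - p.2| ≤ 2 * D := by
    have := abs_sub p'.2 p.2
    linarith [hD _ hc, hD _ hc']
  have h4 : (l : ℝ) * l' ≤ (k : ℝ) ^ 2 := by nlinarith
  have h5 : |p'.2 - p.2| * (l * l') ≤ 2 * D * (k : ℝ) ^ 2 :=
    mul_le_mul h3 h4 (mul_pos hl0 hl0').le (by positivity)
  have h6 : |x| ≤ |x| * |(N : ℝ)| := le_mul_of_one_le_right (abs_nonneg _) hN1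
  rw [abs_of_nonpos hx0] at h6 h2
  linarith

/-! ### The spectral function near infinity. -/

section SpectralFunction

variable {m n : ℕ} {A B : Matrix (Fin m) (Fin n) EReal}

theorem exists_real_specFun (hn : 0 < n) (hA : IsMaxPlus A) (hB : IsMaxPlus B)
    (hrA : NoBotRow A) (hrB : NoBotRow B) (hc : NoCommonBotCol A B) :
    ∃ s : ℝ → ℝ, (∀ lam, specFun A B lam = s lam) ∧ Continuous s ∧ (∀ lam, s lam ≤ 0) ∧
      (∀ lam, ∃ p ∈ cycleLines (means (weights A B) (min (2 * m) n)) (min (2 * m) n),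
        s lam = lam * p.1 + p.2) ∧
      (NoBotCol A → ∃ ρ : ℝ, specRadius (resComp A B) = ρ ∧ (∀ lam, s lam ≤ lam + ρ) ∧
        ∀ D, (∀ w ∈ weights A B, |w| ≤ D) → ρ ≤ D) := by
  choose s hs hx hmax using fun lam : ℝ =>
    (isTopical_hFun hn hA hB hrA hrB hc lam).exists_isGreatest_eigenvalues hn
  choose x hxt hxb hx using hx
  refine ⟨s, hs, ?_, fun lam => ?_, fun lam => ?_, fun hcA => ?_⟩
  · have hle : ∀ lam lam', s lam ≤ s lam' + 1 * dist lam lam' := by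
      intro lam lam'
      have := hmax lam' (-|lam - lam'| + s lam) (x lam) (hxt lam) (hxb lam) fun j => by
        -- The eigenvector at `lam`, lowered by `|lam - lam'|` in its eigenvalue, is a
        -- sub-eigenvector at `lam'`.
        rw [EReal.coe_add, add_assoc, hx]
        exact hFun_lipschitz A B lam lam' (x lam) j
      rw [Real.dist_eq]
      linarith
    exact (LipschitzWith.of_le_add_mul 1 (by simpa using hle)).continuous
  · exact nonpos_of_le_hFun hn hA hB hc (hxt lam) (hxb lam) fun j => (hx lam j).le
  · obtain ⟨l, q, hl1, hlk, hq, c, hcK, h⟩ :=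
      hFun_eigenvalue_eq hn hA hB hc (hxt lam) (hxb lam) (hx lam)
    exact ⟨(((l : ℝ) - 2 * q) / l, c), ⟨⟨l, q, hl1, hlk, hq, rfl⟩, hcK⟩, h⟩
  · obtain ⟨ρ, hρ, ⟨y, hyt, hyb, hy⟩, hρmax⟩ :=
      (isTopical_resComp hn hA hB hrB hcA).exists_isGreatest_eigenvalues hn
    refine ⟨ρ, hρ, fun lam => ?_, fun D hD =>
      resComp_eigenvalue_le hn hA hB hcA hD hyt hyb fun j => (hy j).le⟩
    have := hρmax (-lam + s lam) (x lam) (hxt lam) (hxb lam) fun j => by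
      rw [EReal.coe_add, add_assoc, hx, ← le_coe_add_iff]
      exact inf_le_left
    linarith

theorem specFun_eq_of_le_neg (hn : 0 < n) (hA : IsMaxPlus A) (hB : IsMaxPlus B)
    (hrA : NoBotRow A) (hrB : NoBotRow B) (hc : NoCommonBotCol A B) {D : ℝ}
    (hD : ∀ w ∈ weights A B, |w| ≤ D) :
    ∃ (k l t : ℕ) (α : ℝ), (1 ≤ l ∧ l ≤ min (2 * m) n ∧ t ≤ l / 2 ∧
        (k : ℤ) = (l : ℤ) - 2 * (t : ℤ)) ∧
      ∀ lam : ℝ, lam ≤ -(2 * ((min (2 * m) n : ℕ) : ℝ) ^ 2 * D) →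
        specFun A B lam = ((lam * ((k : ℝ) / (l : ℝ)) + α : ℝ) : EReal) := by
  obtain ⟨s, hs, hcont, hs0, hcyc, -⟩ := exists_real_specFun hn hA hB hrA hrB hc
  obtain ⟨⟨σ, α⟩, ⟨⟨l, t, hl1, hlk, -, hσ⟩, -⟩, h⟩ := exists_affine_of_finite hcont
    (cycleLines_finite (means_finite (weights_finite A B) _) _) (fun x _ => hcyc x)
    (T := -(2 * ((min (2 * m) n : ℕ) : ℝ) ^ 2 * D)) fun p hp p' hp' x hx hxx =>
      cycleLines_not_cross (fun c hc => abs_le_of_mem_means hD hc) hp hp' hx hxx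
  simp only at hσ h
  have hl0 : (0 : ℝ) < l := by exact_mod_cast hl1
  -- Boundedness of `s` above by 0 forces this slope sign, which is exactly `2 * t ≤ l`.
  have hσ0 : 0 ≤ σ := nonneg_slope_of_nonpos (c := α) fun x hx => (h x hx).symm.trans_le (hs0 x)
  have hlt : 2 * t ≤ l := by
    rw [hσ, le_div_iff₀ hl0, zero_mul, sub_nonneg] at hσ0
    exact_mod_cast hσ0
  refine ⟨l - 2 * t, l, t, α, ⟨hl1, hlk, by omega, by omega⟩, fun lam hlam => ?_⟩
  rw [hs, h lam hlam, hσ, Nat.cast_sub hlt]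
  push_cast
  rfl

theorem specFun_eq_add_of_le_neg (hn : 0 < n) (hA : IsMaxPlus A) (hB : IsMaxPlus B)
    (hrA : NoBotRow A) (hrB : NoBotRow B) (hcA : NoBotCol A) {D : ℝ} (hD0 : 0 ≤ D)
    (hD : ∀ w ∈ weights A B, |w| ≤ D) :
    ∃ α : ℝ, (α : EReal) ≤ specRadius (resComp A B) ∧
      ∀ lam : ℝ, lam ≤ -(2 * ((min (2 * m) n : ℕ) : ℝ) * D) →
        specFun A B lam = ((lam + α : ℝ) : EReal) := by
  have hc : NoCommonBotCol A B := fun j => let ⟨i, hi⟩ := hcA j; ⟨i, .inl hi⟩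
  obtain ⟨s, hs, hcont, -, hcyc, hρ⟩ := exists_real_specFun hn hA hB hrA hrB hc
  obtain ⟨ρ, hρ, hsρ, hρD⟩ := hρ hcA
  have hρD := hρD D hD
  obtain ⟨⟨σ, α⟩, hσα, h⟩ : ∃ p ∈ {p : ℝ × ℝ | p.1 = 1 ∧ p.2 ∈ means (weights A B) (min (2 * m) n)},
      ∀ x ≤ -(2 * ((min (2 * m) n : ℕ) : ℝ) * D), s x = x * p.1 + p.2 := by
    refine exists_affine_of_finite hcont
      (((finite_singleton (1 : ℝ)).prod (means_finite (weights_finite A B) _)).subset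
        fun p hp => ⟨hp.1, hp.2⟩) ?_ ?_
    · intro x hx
      obtain ⟨p, ⟨⟨l, q, hl1, hlk, -, hσ⟩, hpK⟩, hp⟩ := hcyc x
      refine ⟨p, ⟨?_, hpK⟩, hp⟩
      have hl0 : (0 : ℝ) < l := by exact_mod_cast hl1
      -- From `x * p.1 + p.2 ≤ x + D` and `p.2 ≥ -D` one gets `-x * q ≤ D * l ≤ κ * D`, with `κ =
      -- min (2 * m) n`. For `q ≥ 1` this contradicts `x < -2κD`.
      suffices hq : q = 0 by rw [hσ, hq]; simp [hl0.ne']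
      by_contra hq
      have hq1 : (1 : ℝ) ≤ q := by exact_mod_cast Nat.one_le_iff_ne_zero.2 hq
      have hlk : (l : ℝ) ≤ ((min (2 * m) n : ℕ) : ℝ) := by exact_mod_cast hlk
      have h1 := hsρ x
      have h2 := (abs_le.1 (abs_le_of_mem_means hD hpK)).1
      have h3 : x * p.1 * l = x * l - 2 * (x * q) := by rw [hσ]; field_simp
      have h4 : x * p.1 * l ≤ (x + 2 * D) * l :=
        mul_le_mul_of_nonneg_right (by linarith) hl0.le
      have h5 : D * l ≤ ((min (2 * m) n : ℕ) : ℝ) * D := by nlinarith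
      have h6 : 0 ≤ D * l := by positivity
      nlinarith
    · rintro p ⟨hp, -⟩ p' ⟨hp', -⟩ x - h
      refine Prod.ext (hp.trans hp'.symm) ?_
      rw [hp, hp'] at h
      linarith
  have hσ : σ = 1 := hσα.1
  simp only at h
  subst hσ
  refine ⟨α, ?_, fun lam hlam => by rw [hs, h lam hlam, mul_one]⟩
  rw [hρ, EReal.coe_le_coe_iff]
  have h1 := h _ le_rfl
  have h2 := hsρ (-(2 * ((min (2 * m) n : ℕ) : ℝ) * D))
  linarith

/-- Adding a real constant to a map shifts its spectral radius. -/
theorem specRadius_coe_add (c : ℝ) (f : (Fin n → EReal) → (Fin n → EReal)) :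
    specRadius (fun x j => (c : EReal) + f x j) = (c : EReal) + specRadius f := by
  have hle : ∀ (c : ℝ) (f : (Fin n → EReal) → (Fin n → EReal)),
      (c : EReal) + specRadius f ≤ specRadius (fun x j => (c : EReal) + f x j) := by
    intro c f
    rw [coe_add_le_iff]
    refine sSup_le ?_
    rintro μ ⟨hμ, x, hxt, hxb, hx⟩
    rw [le_coe_add_iff, neg_neg]
    exact le_sSup ⟨coe_add_ne_top hμ, x, hxt, hxb, fun j => by rw [add_assoc, hx]⟩
  refine le_antisymm ?_ (hle c f)
  -- The reverse inequality is the same one applied to the shifted map and `-c`.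
  have h := hle (-c) fun x j => (c : EReal) + f x j
  simp only [neg_coe_add_cancel_left] at h
  rwa [coe_add_le_iff, neg_neg] at h

/-- Below `Clower`, the two maps in the minimum are ordered pointwise. With `i` optimal for `B♯A`
and `k` optimal for `B x` in row `i`, this is `2λ ≤ (a_ij - b_ik) + (a_ik - b_ij)`. So `h_λ` is a
translate of `A♯B`. -/
theorem specFun_eq_of_le_Clower (hm : 0 < m) (hn : 0 < n) (hA : IsMaxPlus A)
    (hB : IsMaxPlus B) (hfA : ∀ i j, A i j ≠ ⊥) (hfB : ∀ i j, B i j ≠ ⊥) {lam : ℝ}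
    (hlam : (lam : EReal) ≤ Clower A B) :
    specFun A B lam = (lam : EReal) + specRadius (resComp A B) := by
  rw [← specRadius_coe_add, specFun]
  congr 1
  funext x j
  refine inf_eq_left.2 ?_
  have hle : ∀ i j k, lam ≤ (A i k).toReal - (B i j).toReal := fun i j k =>
    EReal.coe_le_coe_iff.1 (hlam.trans (Clower_le_coe_sub hA hB (hfA i k) (hfB i j)))
  obtain ⟨i, hi, hij⟩ := exists_residuated_eq ⟨⟨0, hm⟩, hfB _ j⟩ (act A x)
  obtain ⟨k, hk⟩ := exists_act_eq hn B x i
  calc (lam : EReal) + resComp A B x j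
      ≤ lam + (-A i j + (B i k + x k)) :=
        add_le_add_right ((residuated_le (hfA i j) (act B x)).trans_eq (by rw [hk])) _
    _ = ((lam - (A i j).toReal + (B i k).toReal : ℝ) : EReal) + x k := by
        rw [coe_neg_add_act hA (hfA i j), ← EReal.coe_toReal (hB i k) (hfB i k), ← add_assoc,
          ← add_assoc, ← EReal.coe_add, ← EReal.coe_add, EReal.toReal_coe, sub_eq_add_neg]
    _ ≤ ((-lam - (B i j).toReal + (A i k).toReal : ℝ) : EReal) + x k :=
        add_le_add_left (EReal.coe_le_coe_iff.2 (by linarith [hle i k j, hle i j k])) _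
    _ = ((-lam : ℝ) : EReal) + (-B i j + (A i k + x k)) := by
        rw [coe_neg_add_act hB hi, ← EReal.coe_toReal (hA i k) (hfA i k), ← add_assoc,
          ← add_assoc, ← EReal.coe_add, ← EReal.coe_add, EReal.toReal_coe, sub_eq_add_neg]
    _ ≤ ((-lam : ℝ) : EReal) + resComp B A x j := by
        rw [resComp, hij]
        exact add_le_add_right (add_le_add_right (le_act A x i k) _) _

theorem neg_coe_le_Clower {lam : ℝ} (hA : IsMaxPlus A) (hB : IsMaxPlus B)
    (h : Cupper A B ≤ (lam : EReal)) : ((-lam : ℝ) : EReal) ≤ Clower B A := by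
  refine le_iInf fun i => le_iInf fun j => le_iInf fun k => le_iInf₂ fun hk hj => ?_
  have h1 := EReal.coe_le_coe_iff.1 ((coe_sub_le_Cupper hA hB hj hk).trans h)
  rw [← EReal.coe_toReal (hA i j) hj, ← EReal.coe_toReal (hB i k) hk, ← EReal.coe_sub]
  exact EReal.coe_le_coe_iff.2 (by linarith)

end SpectralFunction

end MaxPlus

end

theorem theorem6 {m n : ℕ} (hn : 0 < n) (A B : Matrix (Fin m) (Fin n) EReal)
    (hA : MaxPlus.IsMaxPlus A) (hB : MaxPlus.IsMaxPlus B)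
    (hrA : MaxPlus.NoBotRow A) (hrB : MaxPlus.NoBotRow B)
    (hc : MaxPlus.NoCommonBotCol A B)
    (κ : ℕ) (hκ : κ = min (2 * m) n) :
    -- general asymptotics
    (∃ (k₁ l₁ t₁ k₂ l₂ t₂ : ℕ) (α₁ α₂ : ℝ),
      (1 ≤ l₁ ∧ l₁ ≤ κ ∧ t₁ ≤ l₁ / 2 ∧ (k₁ : ℤ) = (l₁ : ℤ) - 2 * (t₁ : ℤ)) ∧
      (1 ≤ l₂ ∧ l₂ ≤ κ ∧ t₂ ≤ l₂ / 2 ∧ (k₂ : ℤ) = (l₂ : ℤ) - 2 * (t₂ : ℤ)) ∧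
      (∀ lam : ℝ, (lam : EReal) ≤ -(((2 * (κ : ℝ) ^ 2 : ℝ) : EReal) * MaxPlus.Delta A B) →
        MaxPlus.specFun A B lam = ((lam * ((k₁ : ℝ) / (l₁ : ℝ)) + α₁ : ℝ) : EReal)) ∧
      (∀ lam : ℝ, ((2 * (κ : ℝ) ^ 2 : ℝ) : EReal) * MaxPlus.Delta A B ≤ (lam : EReal) →
        MaxPlus.specFun A B lam = ((-lam * ((k₂ : ℝ) / (l₂ : ℝ)) + α₂ : ℝ) : EReal))) ∧
    -- no `-∞` columns
    (MaxPlus.NoBotCol A → MaxPlus.NoBotCol B →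
      ∃ α₁ α₂ : ℝ,
        (α₁ : EReal) ≤ MaxPlus.specRadius (MaxPlus.resComp A B) ∧
        (α₂ : EReal) ≤ MaxPlus.specRadius (MaxPlus.resComp B A) ∧
        (∀ lam : ℝ, (lam : EReal) ≤ -(((2 * (κ : ℝ) : ℝ) : EReal) * MaxPlus.Delta A B) →
          MaxPlus.specFun A B lam = ((lam + α₁ : ℝ) : EReal)) ∧
        (∀ lam : ℝ, ((2 * (κ : ℝ) : ℝ) : EReal) * MaxPlus.Delta A B ≤ (lam : EReal) →
          MaxPlus.specFun A B lam = ((-lam + α₂ : ℝ) : EReal))) ∧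
    -- real matrices
    ((∀ i j, A i j ≠ ⊥) → (∀ i j, B i j ≠ ⊥) →
      (∀ lam : ℝ, (lam : EReal) ≤ MaxPlus.Clower A B →
        MaxPlus.specFun A B lam =
          (lam : EReal) + MaxPlus.specRadius (MaxPlus.resComp A B)) ∧
      (∀ lam : ℝ, MaxPlus.Cupper A B ≤ (lam : EReal) →
        MaxPlus.specFun A B lam =
          ((-lam : ℝ) : EReal) + MaxPlus.specRadius (MaxPlus.resComp B A))) := by
  subst hκ
  have hm : 0 < m := let ⟨i, _⟩ := hc ⟨0, hn⟩; i.pos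
  have hc' : MaxPlus.NoCommonBotCol B A := fun j => let ⟨i, hi⟩ := hc j; ⟨i, hi.symm⟩
  obtain ⟨D, hΔ, hD0, hD⟩ := MaxPlus.exists_Delta_eq hm hA hB hrA hrB
  have hD' : ∀ w ∈ MaxPlus.weights B A, |w| ≤ D := MaxPlus.weights_comm A B ▸ hD
  simp only [hΔ, ← EReal.coe_mul, ← EReal.coe_neg, EReal.coe_le_coe_iff]
  refine ⟨?_, fun hcA hcB => ?_, fun hfA hfB => ⟨fun lam hlam => ?_, fun lam hlam => ?_⟩⟩
  · obtain ⟨k₁, l₁, t₁, α₁, h₁, hs₁⟩ := MaxPlus.specFun_eq_of_le_neg hn hA hB hrA hrB hc hD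
    obtain ⟨k₂, l₂, t₂, α₂, h₂, hs₂⟩ := MaxPlus.specFun_eq_of_le_neg hn hB hA hrB hrA hc' hD'
    refine ⟨k₁, l₁, t₁, k₂, l₂, t₂, α₁, α₂, h₁, h₂, hs₁, fun lam hlam => ?_⟩
    rw [← MaxPlus.specFun_neg]
    exact hs₂ (-lam) (neg_le_neg hlam)
  · obtain ⟨α₁, hα₁, hs₁⟩ := MaxPlus.specFun_eq_add_of_le_neg hn hA hB hrA hrB hcA hD0 hD
    obtain ⟨α₂, hα₂, hs₂⟩ := MaxPlus.specFun_eq_add_of_le_neg hn hB hA hrB hrA hcB hD0 hD'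
    refine ⟨α₁, α₂, hα₁, hα₂, hs₁, fun lam hlam => ?_⟩
    rw [← MaxPlus.specFun_neg]
    exact hs₂ (-lam) (neg_le_neg hlam)
  · exact MaxPlus.specFun_eq_of_le_Clower hm hn hA hB hfA hfB hlam
  · rw [← MaxPlus.specFun_neg]
    exact MaxPlus.specFun_eq_of_le_Clower hm hn hB hA hfB hfA
      (MaxPlus.neg_coe_le_Clower hA hB hlam)
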